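/- **Setting.** Let $n\ge 1$ and let $\mathbb{R}^n$ carry the dilations $\delta_\lambda(x)=(\lambda^{\sigma_1}x_1,\dots,\lambda^{\sigma_n}x_n)$, $\lambda>0$, with integers $1=\sigma_1\le\sigma_2\le\dots\le\sigma_n$. Let $X_1,\dots,X_m$ be real smooth vector fields on $\mathbb{R}^n$ that are linearly independent (over $\mathbb{R}$, as vector fields), satisfy Hörmander's condition at the origin (the values at $0$ of the Lie algebra $\mathrm{Lie}(X)$ that they generate fill $\mathbb{R}^n$), and are such that each $X_i$ is $\delta_\lambda$-homogeneous of positive integer degree $\nu_i$, i.e. $X_i(u\circ\delta_\lambda)=\lambda^{\nu_i}(X_iu)\circ\delta_\lambda$ for all $\lambda>0$ and $u\in C^\infty(\mathbb{R}^n)$, with $1\le\nu_1\le\dots\le\nu_m$. For a multi-index $I=(i_1,\dots,i_k)$ put $X_I=X_{i_1}\cdots X_{i_k}$ and $|I|=\nu_{i_1}+\dots+\nu_{i_k}$. Let $\nu\ge1$ be an integer, let $c_I\in\mathbb{R}$, and let $$\mathcal{L}=\sum_{|I|=\nu}c_I X_I .$$ **Lifting.** Let $N=\dim\mathrm{Lie}(X)$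 and $p=N-n$. A lifting of $X_1,\dots,X_m$ consists of a homogeneous group $\mathbb{G}=(\mathbb{R}^N,\star,D_\lambda)$ (a Lie group structure on $\mathbb{R}^N=\mathbb{R}^n_x\times\mathbb{R}^p_\xi$ for which the dilations $D_\lambda(x,\xi)=(\delta_\lambda(x),\lambda^{\tau_1}\xi_1,\dots,\lambda^{\tau_p}\xi_p)$, with integers $1\le\tau_1\le\dots\le\tau_p$, are group automorphisms) and of left invariant smooth vector fields $\widetilde X_1,\dots,\widetilde X_m$ on $\mathbb{G}$ that generate the Lie algebra of all left invariant vector fields of $\mathbb{G}$, such that $\widetilde X_j$ is $D_\lambda$-homogeneous of degree $\nu_j$ and $\widetilde X_j=X_j+R_j(x,\xi)$, where $R_j$ is a smooth vector field that differentiates only in $\xi$, with coefficients possibly depending on $(x,\xi)$. A differential operator $P$ with smooth real coefficients is hypoelliptic in an open set $\Omega$ if, for every distribution $\Lambda\in\mathcal{D}'(\Omega)$ and every open $\Omega'\subseteq\Omega$, $P\Lambda\in C^\infty(\Omega')$ implies $\Lambda\in C^\infty(\Omega')$. The operator $\mathcal{L}$ is called a *generalized Rockland operator* if, for some lifting, the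 lifted operator $\widetilde{\mathcal{L}}=\sum_{|I|=\nu}c_I\widetilde X_I$ is hypoelliptic in $\mathbb{R}^N$. **Theorem.** Every generalized Rockland operator $\mathcal{L}$ is hypoelliptic in $\mathbb{R}^n$: for every $\Lambda\in\mathcal{D}'(\mathbb{R}^n)$ and every open $\Omega'\subseteq\mathbb{R}^n$, if $\mathcal{L}\Lambda\in C^\infty(\Omega')$, then $\Lambda\in C^\infty(\Omega')$. -/

import Mathlib

open scoped Distributions ContDiff
open TopologicalSpace MeasureTheory

/-! ### Smooth vector fields on `ℝ^ι` and their Lie algebra -/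

/-- The real vector space of the smooth maps `ℝ^ι → ℝ^ι`. -/
def smoothFields (ι : Type) [Fintype ι] : Submodule ℝ ((ι → ℝ) → (ι → ℝ)) where
  carrier := {V | ContDiff ℝ ∞ V}
  add_mem' {V W} (hV : ContDiff ℝ ∞ V) (hW : ContDiff ℝ ∞ W) := hV.add hW
  zero_mem' := (contDiff_const : ContDiff ℝ ∞ (fun _ : ι → ℝ => (0 : ι → ℝ)))
  smul_mem' a {V} (hV : ContDiff ℝ ∞ V) := hV.const_smul a

/-- A smooth real vector field on `ℝ^ι`; the value `Z x` lists its coefficients,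
`Z = ∑ i, (Z x) i ∂_i`. -/
abbrev SmoothField (ι : Type) [Fintype ι] : Type := smoothFields ι

namespace SmoothField

variable {ι : Type} [Fintype ι]

instance : CoeFun (SmoothField ι) (fun _ => (ι → ℝ) → (ι → ℝ)) := ⟨fun Z => Z.1⟩

theorem contDiff (Z : SmoothField ι) : ContDiff ℝ ∞ Z := Z.2

theorem coe_add (Y Z : SmoothField ι) : ((Y + Z : SmoothField ι) : (ι → ℝ) → (ι → ℝ)) = Y + Z :=
  rfl

theorem coe_smul (a : ℝ) (Z : SmoothField ι) :
    ((a • Z : SmoothField ι) : (ι → ℝ) → (ι → ℝ)) = a • (Z : (ι → ℝ) → (ι → ℝ)) := rfl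

theorem ext {Y Z : SmoothField ι} (h : (Y : (ι → ℝ) → (ι → ℝ)) = Z) : Y = Z := Subtype.ext h

theorem differentiableAt (Z : SmoothField ι) (x : ι → ℝ) : DifferentiableAt ℝ Z x :=
  (Z.contDiff.differentiable (by simp)).differentiableAt

/-- The commutator `[Y, Z] = YZ - ZY`. -/
noncomputable instance : Bracket (SmoothField ι) (SmoothField ι) where
  bracket Y Z := ⟨VectorField.lieBracket ℝ Y Z,
    ContDiff.lieBracket_vectorField (n := ∞) Y.contDiff Z.contDiff (m := ∞) (by simp)⟩

theorem coe_bracket (Y Z : SmoothField ι) :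
    ((⁅Y, Z⁆ : SmoothField ι) : (ι → ℝ) → (ι → ℝ)) = VectorField.lieBracket ℝ Y Z := rfl

noncomputable instance : LieRing (SmoothField ι) where
  add_lie X Y Z := ext <| by
    funext x
    exact VectorField.lieBracket_add_left (X.differentiableAt x) (Y.differentiableAt x)
  lie_add X Y Z := ext <| by
    funext x
    exact VectorField.lieBracket_add_right (Y.differentiableAt x) (Z.differentiableAt x)
  lie_self X := ext VectorField.lieBracket_self
  leibniz_lie X Y Z := ext <| by
    funext x
    exact VectorField.leibniz_identity_lieBracket (n := ∞) (by simp; exact WithTop.coe_le_coe.2 (le_top : (2 : ℕ∞) ≤ ⊤))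
      X.contDiff.contDiffAt Y.contDiff.contDiffAt Z.contDiff.contDiffAt

noncomputable instance : LieAlgebra ℝ (SmoothField ι) where
  lie_smul a Y Z := ext <| by
    funext x
    exact VectorField.lieBracket_const_smul_right (Z.differentiableAt x)

/-- The first-order operator `Z u = ∑ i, (Z x) i ∂_i u` defined by a vector field. -/
noncomputable def act (Z : SmoothField ι) (u : (ι → ℝ) → ℝ) : (ι → ℝ) → ℝ :=
  fun x => fderiv ℝ u x (Z x)

/-- The formal transpose `Z* φ = -∑ i, ∂_i (Z_i φ)` of a vector field. -/
noncomputable def transpose [DecidableEq ι] (Z : SmoothField ι) (φ : (ι → ℝ) → ℝ) :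
    (ι → ℝ) → ℝ :=
  fun x => -∑ i, fderiv ℝ (fun y => Z y i * φ y) x (Pi.single i 1)

theorem contDiff_coord (Z : SmoothField ι) (i : ι) : ContDiff ℝ ∞ (fun y => Z y i) :=
  contDiff_pi.1 Z.contDiff i

theorem contDiff_act (Z : SmoothField ι) {u : (ι → ℝ) → ℝ} (hu : ContDiff ℝ ∞ u) :
    ContDiff ℝ ∞ (Z.act u) :=
  (hu.fderiv_right (m := ∞) (by simp)).clm_apply Z.contDiff

theorem tsupport_transpose_subset [DecidableEq ι] (Z : SmoothField ι) (φ : (ι → ℝ) → ℝ) :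
    tsupport (Z.transpose φ) ⊆ tsupport φ := by
  refine closure_minimal (fun x hx => ?_) (isClosed_tsupport φ)
  by_contra hne
  refine hx ?_
  have h : ∀ i, fderiv ℝ (fun y => Z y i * φ y) x = 0 := fun i => by
    have h0 : (fun y => Z y i * φ y) =ᶠ[nhds x] fun _ => 0 := by
      filter_upwards [notMem_tsupport_iff_eventuallyEq.1 hne] with y hy
      simp [hy]
    rw [h0.fderiv_eq]
    exact fderiv_const_apply 0
  simp [transpose, h]

/-- The formal transpose of a vector field, acting on the test functions on `Ω`. -/
noncomputable def transposeTest [DecidableEq ι] {Ω : Opens (ι → ℝ)} (Z : SmoothField ι)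
    (φ : 𝓓(Ω, ℝ)) : 𝓓(Ω, ℝ) where
  toFun := Z.transpose φ
  contDiff' := by
    refine (ContDiff.sum fun i _ => ?_).neg
    exact ((((Z.contDiff_coord i).mul φ.contDiff).fderiv_right (m := ∞) (by simp)).clm_apply
      contDiff_const)
  hasCompactSupport' :=
    φ.hasCompactSupport.of_isClosed_subset (isClosed_tsupport _) (Z.tsupport_transpose_subset φ)
  tsupport_subset' := (Z.tsupport_transpose_subset φ).trans φ.tsupport_subset

end SmoothField

/-! ### Differential operators `∑ c_I X_I` and hypoellipticity -/

section Operators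

variable {ι κ : Type} [Fintype ι]

/-- `X_I u = X_{i₁} (X_{i₂} (⋯ (X_{i_k} u)))` for the multi-index `I = (i₁, …, i_k)`. -/
noncomputable def wordOp (X : κ → SmoothField ι) (I : List κ) (u : (ι → ℝ) → ℝ) : (ι → ℝ) → ℝ :=
  I.foldr (fun i v => (X i).act v) u

/-- The differential operator `𝓛 = ∑_I c_I X_I` (a finite sum) on functions. -/
noncomputable def diffOp (X : κ → SmoothField ι) (c : List κ →₀ ℝ) (u : (ι → ℝ) → ℝ) :
    (ι → ℝ) → ℝ :=
  ∑ I ∈ c.support, c I • wordOp X I u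

/-- `(X_I)* φ = X_{i_k}* (⋯ (X_{i₂}* (X_{i₁}* φ)))` for the multi-index `I = (i₁, …, i_k)`. -/
noncomputable def wordTranspose [DecidableEq ι] {Ω : Opens (ι → ℝ)} (X : κ → SmoothField ι) (I : List κ)
    (φ : 𝓓(Ω, ℝ)) : 𝓓(Ω, ℝ) :=
  I.foldl (fun ψ i => (X i).transposeTest ψ) φ

/-- The formal transpose `𝓛* = ∑_I c_I (X_I)*`, acting on the test functions on `Ω`. -/
noncomputable def diffOpTranspose [DecidableEq ι] {Ω : Opens (ι → ℝ)} (X : κ → SmoothField ι) (c : List κ →₀ ℝ)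
    (φ : 𝓓(Ω, ℝ)) : 𝓓(Ω, ℝ) :=
  ∑ I ∈ c.support, c I • wordTranspose X I φ

theorem contDiff_wordOp (X : κ → SmoothField ι) (I : List κ) {u : (ι → ℝ) → ℝ}
    (hu : ContDiff ℝ ∞ u) : ContDiff ℝ ∞ (wordOp X I u) := by
  induction I with
  | nil => exact hu
  | cons i I ih => exact (X i).contDiff_act ih

/-- The defining property `∫ (Z u) φ = ∫ u (Z* φ)` of the formal transpose. -/
theorem integral_act_mul [DecidableEq ι] {Ω : Opens (ι → ℝ)} (Z : SmoothField ι) {u : (ι → ℝ) → ℝ}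
    (hu : ContDiff ℝ ∞ u) (φ : 𝓓(Ω, ℝ)) :
    ∫ x, Z.act u x * φ x = ∫ x, u x * Z.transposeTest φ x := by
  have hg : ∀ i, ContDiff ℝ ∞ (fun y => Z y i * φ y) :=
    fun i => (Z.contDiff_coord i).mul φ.contDiff
  have hgs : ∀ i, HasCompactSupport (fun y => Z y i * φ y) :=
    fun i => φ.hasCompactSupport.mul_left
  have hd : ∀ i, Continuous (fun x => fderiv ℝ (fun y => Z y i * φ y) x (Pi.single i 1)) :=
    fun i => (((hg i).continuous_fderiv (by simp)).clm_apply continuous_const)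
  have hds : ∀ i, HasCompactSupport
      (fun x => fderiv ℝ (fun y => Z y i * φ y) x (Pi.single i 1)) :=
    fun i => (hgs i).fderiv_apply ℝ _
  have hud : ∀ i : ι, Continuous (fun x => fderiv ℝ u x (Pi.single i 1)) :=
    fun i => ((hu.continuous_fderiv (by simp)).clm_apply continuous_const)
  have h1 : ∀ i, Integrable (fun x => fderiv ℝ u x (Pi.single i 1) * (Z x i * φ x)) := fun i =>
    ((hud i).mul (hg i).continuous).integrable_of_hasCompactSupport (hgs i).mul_left
  have h2 : ∀ i, Integrable
      (fun x => u x * fderiv ℝ (fun y => Z y i * φ y) x (Pi.single i 1)) := fun i =>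
    (hu.continuous.mul (hd i)).integrable_of_hasCompactSupport (hds i).mul_left
  have h3 : ∀ i, Integrable (fun x => u x * (Z x i * φ x)) := fun i =>
    (hu.continuous.mul (hg i).continuous).integrable_of_hasCompactSupport (hgs i).mul_left
  have h2' : ∀ i, Integrable
      (fun x => -(u x * fderiv ℝ (fun y => Z y i * φ y) x (Pi.single i 1))) :=
    fun i => (h2 i).neg
  have hL : ∀ x, Z.act u x * φ x = ∑ i, fderiv ℝ u x (Pi.single i 1) * (Z x i * φ x) := by
    intro x
    have hz : Z x = ∑ i, Z x i • (Pi.single i (1 : ℝ) : ι → ℝ) := by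
      simpa using pi_eq_sum_univ' (Z x)
    rw [SmoothField.act]
    conv_lhs => rw [hz]
    rw [map_sum, Finset.sum_mul]
    refine Finset.sum_congr rfl fun i _ => ?_
    rw [map_smul, smul_eq_mul]
    ring
  have hR : ∀ x, u x * Z.transposeTest φ x =
      ∑ i, -(u x * fderiv ℝ (fun y => Z y i * φ y) x (Pi.single i 1)) := by
    intro x
    change u x * (-∑ i, fderiv ℝ (fun y => Z y i * φ y) x (Pi.single i 1)) = _
    rw [mul_neg, Finset.mul_sum, Finset.sum_neg_distrib]
  simp_rw [hL, hR]
  rw [integral_finsetSum _ fun i _ => h1 i, integral_finsetSum _ fun i _ => h2' i]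
  refine Finset.sum_congr rfl fun i _ => ?_
  rw [integral_neg, integral_mul_fderiv_eq_neg_fderiv_mul_of_integrable (h1 i) (h2 i) (h3 i)
    (fun x _ => (hu.differentiable (by simp)).differentiableAt)
    (fun x _ => ((hg i).differentiable (by simp)).differentiableAt), neg_neg]

theorem integral_wordOp_mul [DecidableEq ι] {Ω : Opens (ι → ℝ)} (X : κ → SmoothField ι) (I : List κ)
    {u : (ι → ℝ) → ℝ} (hu : ContDiff ℝ ∞ u) (φ : 𝓓(Ω, ℝ)) :
    ∫ x, wordOp X I u x * φ x = ∫ x, u x * wordTranspose X I φ x := by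
  induction I generalizing φ with
  | nil => rfl
  | cons i I ih =>
    exact (integral_act_mul (X i) (contDiff_wordOp X I hu) φ).trans (ih _)

/-- The defining property `∫ (𝓛 u) φ = ∫ u (𝓛* φ)` of the formal transpose. -/
theorem integral_diffOp_mul [DecidableEq ι] {Ω : Opens (ι → ℝ)} (X : κ → SmoothField ι) (c : List κ →₀ ℝ)
    {u : (ι → ℝ) → ℝ} (hu : ContDiff ℝ ∞ u) (φ : 𝓓(Ω, ℝ)) :
    ∫ x, diffOp X c u x * φ x = ∫ x, u x * diffOpTranspose X c φ x := by
  have hi : ∀ v : (ι → ℝ) → ℝ, ContDiff ℝ ∞ v → ∀ ψ : 𝓓(Ω, ℝ),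
      Integrable (fun x => v x * ψ x) := fun v hv ψ =>
    (hv.continuous.mul ψ.continuous).integrable_of_hasCompactSupport ψ.hasCompactSupport.mul_left
  have hc : ∀ x, diffOpTranspose X c φ x = ∑ I ∈ c.support, c I * wordTranspose X I φ x := by
    intro x
    have h : ∀ s : Finset (List κ), (∑ I ∈ s, c I • wordTranspose X I φ : 𝓓(Ω, ℝ)) x =
        ∑ I ∈ s, c I * wordTranspose X I φ x := by
      classical
      intro s
      induction s using Finset.induction_on with
      | empty => rfl
      | insert a s ha ih =>
        rw [Finset.sum_insert ha, Finset.sum_insert ha, ← ih]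
        rfl
    exact h _
  have hl : ∀ x, diffOp X c u x * φ x = ∑ I ∈ c.support, c I * (wordOp X I u x * φ x) := by
    intro x
    simp [diffOp, Finset.sum_mul, mul_assoc]
  have hr : ∀ x, u x * diffOpTranspose X c φ x =
      ∑ I ∈ c.support, c I * (u x * wordTranspose X I φ x) := by
    intro x
    rw [hc, Finset.mul_sum]
    exact Finset.sum_congr rfl fun I _ => by ring
  simp_rw [hl, hr]
  rw [integral_finsetSum _ fun I _ => (hi _ (contDiff_wordOp X I hu) φ).const_mul _,
    integral_finsetSum _ fun I _ => (hi _ hu (wordTranspose X I φ)).const_mul _]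
  refine Finset.sum_congr rfl fun I _ => ?_
  rw [integral_const_mul, integral_const_mul, integral_wordOp_mul X I hu φ]

/-- The function `f` is smooth on `Ω'`, and the functional `T` on test functions on `Ω` is given
on `Ω'` by integration against `f`. -/
def IsSmoothDensityOn {Ω : Opens (ι → ℝ)} (T : 𝓓(Ω, ℝ) → ℝ) (Ω' : Opens (ι → ℝ))
    (f : (ι → ℝ) → ℝ) : Prop :=
  ContDiffOn ℝ ∞ f Ω' ∧ ∀ φ : 𝓓(Ω, ℝ), tsupport φ ⊆ (Ω' : Set (ι → ℝ)) → T φ = ∫ x, f x * φ x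

/-- `𝓛 = ∑_I c_I X_I` is hypoelliptic in `Ω`: for every distribution `Λ ∈ 𝓓'(Ω)` and every open
`Ω' ⊆ Ω`, if `𝓛Λ ∈ C^∞(Ω')` then `Λ ∈ C^∞(Ω')`. Here `⟨𝓛Λ, φ⟩ = ⟨Λ, 𝓛* φ⟩`. -/
def HypoellipticIn [DecidableEq ι] (Ω : Opens (ι → ℝ)) (X : κ → SmoothField ι) (c : List κ →₀ ℝ) : Prop :=
  ∀ Λ : 𝓓'(Ω, ℝ), ∀ Ω' : Opens (ι → ℝ), Ω' ≤ Ω →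
    (∃ f, IsSmoothDensityOn (fun φ => Λ (diffOpTranspose X c φ)) Ω' f) →
    ∃ u, IsSmoothDensityOn (fun φ => Λ φ) Ω' u

end Operators

/-! ### Dilations, homogeneous vector fields, homogeneous groups -/

/-- The dilation `δ_r x = (r^{w₁} x₁, …, r^{w_n} x_n)`. -/
def dilation {ι : Type} (w : ι → ℕ) (r : ℝ) (x : ι → ℝ) : ι → ℝ := fun i => r ^ w i * x i

/-- The vector field `Z` is homogeneous of degree `k`: `Z (u ∘ δ_r) = r^k (Z u) ∘ δ_r`. -/
def IsHomogeneousField {ι : Type} [Fintype ι] (w : ι → ℕ) (k : ℕ) (Z : SmoothField ι) : Prop :=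
  ∀ r : ℝ, 0 < r → ∀ u : (ι → ℝ) → ℝ, ContDiff ℝ ∞ u →
    Z.act (u ∘ dilation w r) = r ^ k • (Z.act u ∘ dilation w r)

/-- A homogeneous group: a Lie group structure on `ℝ^ι` for which the dilations with positive
exponents `w` are group automorphisms. -/
structure HomogeneousGroup (ι : Type) [Fintype ι] (w : ι → ℕ) where
  mul : (ι → ℝ) → (ι → ℝ) → (ι → ℝ)
  one : ι → ℝ
  inv : (ι → ℝ) → (ι → ℝ)
  mul_assoc : ∀ x y z, mul (mul x y) z = mul x (mul y z)
  one_mul : ∀ x, mul one x = x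
  mul_one : ∀ x, mul x one = x
  inv_mul : ∀ x, mul (inv x) x = one
  mul_inv : ∀ x, mul x (inv x) = one
  contDiff_mul : ContDiff ℝ ∞ (fun z : (ι → ℝ) × (ι → ℝ) => mul z.1 z.2)
  contDiff_inv : ContDiff ℝ ∞ inv
  weight_pos : ∀ i, 0 < w i
  dilation_mul : ∀ r : ℝ, 0 < r → ∀ x y,
    dilation w r (mul x y) = mul (dilation w r x) (dilation w r y)

/-- The vector field `Z` is left invariant: `Z (u ∘ τ_g) = (Z u) ∘ τ_g` for the left
translations `τ_g`. -/
def HomogeneousGroup.IsLeftInvariant {ι : Type} [Fintype ι] {w : ι → ℕ}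
    (G : HomogeneousGroup ι w) (Z : SmoothField ι) : Prop :=
  ∀ g, ∀ u : (ι → ℝ) → ℝ, ContDiff ℝ ∞ u → Z.act (u ∘ G.mul g) = Z.act u ∘ G.mul g

/-! ### Generalized Rockland operators -/

/-- The Lie algebra `Lie(X)` generated by a family of smooth vector fields. -/
noncomputable def lieGen {ι κ : Type} [Fintype ι] (X : κ → SmoothField ι) :
    LieSubalgebra ℝ (SmoothField ι) :=
  LieSubalgebra.lieSpan ℝ (SmoothField ι) (Set.range X)

/-- The standing assumptions on the vector fields `X₁, …, X_m` on `ℝⁿ`, with dilation exponents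
`σ` and homogeneity degrees `ν`. -/
structure HomogeneousHormanderSystem {n m : ℕ} [NeZero n] (σ : Fin n → ℕ) (ν : Fin m → ℕ)
    (X : Fin m → SmoothField (Fin n)) : Prop where
  linearIndependent : LinearIndependent ℝ X
  /-- Hörmander's condition at the origin. -/
  hormander_zero : ∀ v : Fin n → ℝ, ∃ Z ∈ lieGen X, Z 0 = v
  σ_zero : σ 0 = 1
  σ_mono : Monotone σ
  ν_pos : ∀ i, 1 ≤ ν i
  ν_mono : Monotone ν
  homogeneous : ∀ i, IsHomogeneousField σ (ν i) (X i)

/-- `X̃₁, …, X̃_m`, on a homogeneous group `G` on `ℝ^N = ℝⁿ × ℝᵖ` with dilations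
`D_r(x, ξ) = (δ_r x, E_r ξ)`, is a lifting of `X₁, …, X_m`; here `N = dim Lie(X)`. A point `z` of
`ℝⁿ × ℝᵖ` is `(x, ξ)` with `x i = z (inl i)` and `ξ j = z (inr j)`. -/
structure IsLifting {n m p : ℕ} {σ : Fin n → ℕ} {τ : Fin p → ℕ} (ν : Fin m → ℕ)
    (X : Fin m → SmoothField (Fin n)) (G : HomogeneousGroup (Fin n ⊕ Fin p) (Sum.elim σ τ))
    (Xl : Fin m → SmoothField (Fin n ⊕ Fin p)) : Prop where
  dim_eq : n + p = Module.finrank ℝ (lieGen X)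
  τ_mono : Monotone τ
  leftInvariant : ∀ j, G.IsLeftInvariant (Xl j)
  /-- `Lie(X̃) = Lie(G)`. -/
  generates : ∀ Z : SmoothField (Fin n ⊕ Fin p), Z ∈ lieGen Xl ↔ G.IsLeftInvariant Z
  homogeneous : ∀ j, IsHomogeneousField (Sum.elim σ τ) (ν j) (Xl j)
  /-- `X̃_j = X_j + R_j`, where `R_j` acts only in the variable `ξ`. -/
  lifts : ∀ j, ∀ z : Fin n ⊕ Fin p → ℝ, ∀ i : Fin n,
    Xl j z (Sum.inl i) = X j (fun k => z (Sum.inl k)) i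

/-- `𝓛 = ∑_{|I| = d} c_I X_I` is a generalized Rockland operator: the `X_i` satisfy the standing
assumptions, only multi-indices `I` of weight `|I| = ∑ ν_{i_h} = d` occur, where `d ≥ 1`, and the
lifted operator `𝓛̃ = ∑ c_I X̃_I` is hypoelliptic on the lifted space `ℝⁿ × ℝᵖ`. -/
structure IsGeneralizedRockland {n m : ℕ} [NeZero n] (σ : Fin n → ℕ) (ν : Fin m → ℕ)
    (X : Fin m → SmoothField (Fin n)) (d : ℕ) (c : List (Fin m) →₀ ℝ) : Prop where
  system : HomogeneousHormanderSystem σ ν X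
  degree_pos : 0 < d
  weight_eq : ∀ I ∈ c.support, (I.map ν).sum = d
  lifted_hypoelliptic : ∃ (p : ℕ) (τ : Fin p → ℕ)
    (G : HomogeneousGroup (Fin n ⊕ Fin p) (Sum.elim σ τ))
    (Xl : Fin m → SmoothField (Fin n ⊕ Fin p)), IsLifting ν X G Xl ∧ HypoellipticIn ⊤ Xl c

/-! Pull `Λ` back to the lifted space, use hypoellipticity there, and average the result over the
fibres. Write π(x, ξ) = x and let π_* be integration in ξ. The distribution Λ ⊗ 1 is φ ↦ Λ(π_* φ).

The key identity is π_*(X̃_j* φ) = X_j*(π_* φ) for test functions φ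
(`SmoothField.IsLiftOf.fiberIntegral_transpose`). The ∂_ξ terms of X̃_j* φ integrate to zero along
the fibres, and the ∂_x coefficients do not depend on ξ. Iterating over words and summing gives 𝓛̃(Λ
⊗ 1) = (𝓛Λ) ⊗ 1 (`fiberIntegralTest_diffOpTranspose`).

If 𝓛Λ = f is smooth on Ω', then 𝓛̃(Λ ⊗ 1) = f ∘ π is smooth on the cylinder π⁻¹(Ω'), so Λ ⊗ 1 has a
smooth density u there. Testing against φ(x)χ(ξ) with ∫χ = 1 shows that Λ has the smooth density ∫
u(x, ξ)χ(ξ) dξ on Ω' (`HypoellipticIn.of_lift`).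

The analytic work lies in showing that π_* is continuous on test functions, which makes Λ ⊗ 1 a
distribution. -/

/-! ### Coordinate projections of compact sets. -/

section Projections

variable {ι κ : Type}

/-- The projection of a subset of `ℝ^ι × ℝ^κ` to `ℝ^ι`. -/
def projLeft (K : Set (ι ⊕ κ → ℝ)) : Set (ι → ℝ) := (fun z i => z (Sum.inl i)) '' K

/-- The projection of a subset of `ℝ^ι × ℝ^κ` to `ℝ^κ`. -/
def projRight (K : Set (ι ⊕ κ → ℝ)) : Set (κ → ℝ) := (fun z k => z (Sum.inr k)) '' K

theorem isCompact_projLeft {K : Set (ι ⊕ κ → ℝ)} (hK : IsCompact K) : IsCompact (projLeft K) :=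
  hK.image (by fun_prop)

theorem isCompact_projRight {K : Set (ι ⊕ κ → ℝ)} (hK : IsCompact K) : IsCompact (projRight K) :=
  hK.image (by fun_prop)

theorem mem_projLeft {K : Set (ι ⊕ κ → ℝ)} {x : ι → ℝ} {ξ : κ → ℝ} (h : Sum.elim x ξ ∈ K) :
    x ∈ projLeft K := ⟨_, h, rfl⟩

theorem mem_projRight {K : Set (ι ⊕ κ → ℝ)} {x : ι → ℝ} {ξ : κ → ℝ} (h : Sum.elim x ξ ∈ K) :
    ξ ∈ projRight K := ⟨_, h, rfl⟩

end Projections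

/-! ### Fibre integrals: smoothness, support and derivative bounds. -/

section FiberIntegral

set_option linter.unusedSectionVars false

variable {ι κ : Type} [Fintype ι] [Fintype κ]

theorem contDiff_sumElim {n : WithTop ℕ∞} :
    ContDiff ℝ n (fun q : (ι → ℝ) × (κ → ℝ) => (Sum.elim q.1 q.2 : ι ⊕ κ → ℝ)) := by
  refine contDiff_pi.2 ?_
  rintro (i | k)
  · exact (contDiff_apply ℝ ℝ i).comp contDiff_fst
  · exact (contDiff_apply ℝ ℝ k).comp contDiff_snd

/-- The linear embedding `x ↦ (x, 0)`. -/
noncomputable def inlCLM (ι κ : Type) [Fintype ι] [Fintype κ] :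
    (ι → ℝ) →L[ℝ] (ι ⊕ κ → ℝ) :=
  LinearMap.toContinuousLinearMap
    { toFun := fun x => Sum.elim x 0
      map_add' := fun x y => by ext (i | k) <;> simp
      map_smul' := fun r x => by ext (i | k) <;> simp }

/-- The linear embedding `ξ ↦ (0, ξ)`. -/
noncomputable def inrCLM (ι κ : Type) [Fintype ι] [Fintype κ] :
    (κ → ℝ) →L[ℝ] (ι ⊕ κ → ℝ) :=
  LinearMap.toContinuousLinearMap
    { toFun := fun x => Sum.elim (0 : ι → ℝ) x
      map_add' := fun x y => by ext (i | k) <;> simp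
      map_smul' := fun r x => by ext (i | k) <;> simp }

theorem inlCLM_apply (x : ι → ℝ) : inlCLM ι κ x = Sum.elim x (0 : κ → ℝ) := rfl

theorem inrCLM_apply (ξ : κ → ℝ) : inrCLM ι κ ξ = Sum.elim (0 : ι → ℝ) ξ := rfl

theorem norm_inlCLM_le : ‖inlCLM ι κ‖ ≤ 1 := by
  refine ContinuousLinearMap.opNorm_le_bound _ zero_le_one fun x => ?_
  rw [one_mul, pi_norm_le_iff_of_nonneg (norm_nonneg _)]
  rintro (i | k)
  · exact norm_le_pi_norm x i
  · simp [inlCLM_apply]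

theorem hasFDerivAt_sumElim_left (x : ι → ℝ) (ξ : κ → ℝ) :
    HasFDerivAt (fun y => (Sum.elim y ξ : ι ⊕ κ → ℝ)) (inlCLM ι κ) x := by
  have h : (fun y => (Sum.elim y ξ : ι ⊕ κ → ℝ)) = fun y => inlCLM ι κ y + inrCLM ι κ ξ := by
    funext y
    ext (i | k) <;> simp [inlCLM_apply, inrCLM_apply]
  rw [h]
  exact (inlCLM ι κ).hasFDerivAt.add_const _

theorem hasFDerivAt_sumElim_right (x : ι → ℝ) (ξ : κ → ℝ) :
    HasFDerivAt (fun η => (Sum.elim x η : ι ⊕ κ → ℝ)) (inrCLM ι κ) ξ := by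
  have h : (fun η => (Sum.elim x η : ι ⊕ κ → ℝ)) = fun η => inlCLM ι κ x + inrCLM ι κ η := by
    funext y
    ext (i | k) <;> simp [inlCLM_apply, inrCLM_apply]
  rw [h]
  exact (inrCLM ι κ).hasFDerivAt.const_add _

theorem continuous_sumElim_right (x : ι → ℝ) :
    Continuous (fun ξ : κ → ℝ => (Sum.elim x ξ : ι ⊕ κ → ℝ)) :=
  (contDiff_sumElim (n := 0)).continuous.comp (Continuous.prodMk_right x)

theorem hasCompactSupport_fiber {E : Type*} [NormedAddCommGroup E] {F : (ι ⊕ κ → ℝ) → E} (hF : HasCompactSupport F) (x : ι → ℝ) :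
    HasCompactSupport (fun ξ : κ → ℝ => F (Sum.elim x ξ)) :=
  HasCompactSupport.intro (isCompact_projRight hF) fun _ hξ =>
    image_eq_zero_of_notMem_tsupport fun h => hξ (mem_projRight h)

variable {E : Type*} [NormedAddCommGroup E] [NormedSpace ℝ E]

theorem integrable_fiber {F : (ι ⊕ κ → ℝ) → E} (hc : Continuous F) (hF : HasCompactSupport F)
    (x : ι → ℝ) : Integrable (fun ξ : κ → ℝ => F (Sum.elim x ξ)) :=
  (hc.comp (continuous_sumElim_right x)).integrable_of_hasCompactSupport
    (hasCompactSupport_fiber hF x)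

/-- Integration over the fibres of `ℝ^ι × ℝ^κ → ℝ^ι`. -/
noncomputable def fiberIntegral (F : (ι ⊕ κ → ℝ) → E) (x : ι → ℝ) : E :=
  ∫ ξ : κ → ℝ, F (Sum.elim x ξ)

/-- A parametric integral of a smooth function, compactly supported in the integration variable
uniformly in the parameter, is smooth. -/
theorem contDiffOn_integral_of_compact {P : Type*} [NormedAddCommGroup P] [NormedSpace ℝ P]
    [CompleteSpace E] {s : Set P} {k : Set (κ → ℝ)} {g : P → (κ → ℝ) → E} (hs : IsOpen s)
    (hk : IsCompact k) (hgs : ∀ p ξ, p ∈ s → ξ ∉ k → g p ξ = 0)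
    (hg : ContDiffOn ℝ ∞ (fun q : P × (κ → ℝ) => g q.1 q.2) (s ×ˢ Set.univ)) :
    ContDiffOn ℝ ∞ (fun p => ∫ ξ, g p ξ) s := by
  -- The integral is the convolution of the constant 1 with `g p`, evaluated at 0; the reflection ξ
  -- ↦ -ξ this introduces preserves Lebesgue measure.
  have h := contDiffOn_convolution_right_with_param_comp (μ := (volume : Measure (κ → ℝ)))
    (n := ⊤) (ContinuousLinearMap.lsmul ℝ ℝ : ℝ →L[ℝ] E →L[ℝ] E) (v := fun _ => 0)
    (f := fun _ => (1 : ℝ)) (g := g) contDiffOn_const hs hk hgs (locallyIntegrable_const 1) hg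
  refine h.congr fun p _ => ?_
  simp only [MeasureTheory.convolution, ContinuousLinearMap.lsmul_apply, one_smul, zero_sub]
  exact (integral_neg_eq_self (g p) volume).symm

theorem contDiff_fiberIntegral [CompleteSpace E] {F : (ι ⊕ κ → ℝ) → E} (hF : ContDiff ℝ ∞ F)
    (hs : HasCompactSupport F) : ContDiff ℝ ∞ (fiberIntegral F) := by
  rw [← contDiffOn_univ]
  refine contDiffOn_integral_of_compact isOpen_univ (isCompact_projRight hs)
    (fun p ξ _ hξ => image_eq_zero_of_notMem_tsupport fun h => hξ (mem_projRight h)) ?_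
  exact (hF.comp contDiff_sumElim).contDiffOn

theorem fiberIntegral_eq_zero {F : (ι ⊕ κ → ℝ) → E} {K : Set (ι ⊕ κ → ℝ)}
    (hK : ∀ z ∉ K, F z = 0) {x : ι → ℝ} (hx : x ∉ projLeft K) : fiberIntegral F x = 0 :=
  integral_eq_zero_of_ae (.of_forall fun _ => hK _ fun h => hx (mem_projLeft h))

theorem tsupport_fiberIntegral_subset {F : (ι ⊕ κ → ℝ) → E} (hs : HasCompactSupport F) :
    tsupport (fiberIntegral F) ⊆ projLeft (tsupport F) :=
  closure_minimal (fun x hx => by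
    by_contra h
    exact hx (fiberIntegral_eq_zero (fun z => image_eq_zero_of_notMem_tsupport) h))
    (isCompact_projLeft hs).isClosed

theorem hasFDerivAt_fiberIntegral {F : (ι ⊕ κ → ℝ) → E} (hF : ContDiff ℝ ∞ F)
    (hs : HasCompactSupport F) (x : ι → ℝ) :
    HasFDerivAt (fiberIntegral F)
      (fiberIntegral (fun z => (fderiv ℝ F z).comp (inlCLM ι κ)) x) x := by
  have hc : Continuous (fun z => (fderiv ℝ F z).comp (inlCLM ι κ)) :=
    (hF.continuous_fderiv (by simp)).clm_comp continuous_const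
  have hz : ∀ z, z ∉ tsupport F → (fderiv ℝ F z).comp (inlCLM ι κ) = 0 := fun z hz => by
    have : fderiv ℝ F z = 0 := by
      by_contra h
      exact hz (support_fderiv_subset ℝ h)
    rw [this, ContinuousLinearMap.zero_comp]
  have hcs : HasCompactSupport (fun z => (fderiv ℝ F z).comp (inlCLM ι κ)) :=
    HasCompactSupport.intro hs hz
  obtain ⟨C, hC⟩ := hc.bounded_above_of_compact_support hcs
  -- The dominating function is a global bound for the derivative, cut off to the ξ-projection of
  -- the support; this works for every base point at once.
  have hk := isCompact_projRight hs
  refine hasFDerivAt_integral_of_dominated_of_fderiv_le (s := Set.univ)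
    (F' := fun y ξ => (fderiv ℝ F (Sum.elim y ξ)).comp (inlCLM ι κ))
    (bound := (projRight (tsupport F)).indicator fun _ => C) Filter.univ_mem
    (.of_forall fun y => (integrable_fiber hF.continuous hs y).aestronglyMeasurable)
    (integrable_fiber hF.continuous hs x)
    (integrable_fiber hc hcs x).aestronglyMeasurable
    (.of_forall fun ξ y _ => ?_) ?_ (.of_forall fun ξ y _ => ?_)
  · by_cases h : ξ ∈ projRight (tsupport F)
    · rw [Set.indicator_of_mem h]
      exact hC _
    · rw [Set.indicator_of_notMem h, hz _ fun h' => h (mem_projRight h'), norm_zero]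
  · rw [integrable_indicator_iff hk.measurableSet]
    exact integrableOn_const hk.measure_lt_top.ne
  · exact ((hF.differentiable (by simp)).differentiableAt.hasFDerivAt).comp y
      (hasFDerivAt_sumElim_left y ξ)

theorem norm_fiberIntegral_le {F : (ι ⊕ κ → ℝ) → E} {K : Set (ι ⊕ κ → ℝ)} (hK : IsCompact K)
    (hF : ∀ z ∉ K, F z = 0) {B : ℝ} (hB : ∀ z, ‖F z‖ ≤ B) (x : ι → ℝ) :
    ‖fiberIntegral F x‖ ≤ volume.real (projRight K) * B := by
  have h : fiberIntegral F x = ∫ ξ in projRight K, F (Sum.elim x ξ) :=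
    (setIntegral_eq_integral_of_forall_compl_eq_zero fun ξ hξ =>
      hF _ fun h => hξ (mem_projRight h)).symm
  rw [h, mul_comm]
  exact norm_setIntegral_le_of_norm_le_const (isCompact_projRight hK).measure_lt_top
    fun ξ _ => hB _

/-- Differentiating a fibre integral gives the fibre integral of a derivative with values in a space
of linear maps, hence the induction over all target spaces `E`. The set `K` stays fixed, since
derivatives also vanish off it, so the volume factor enters only once. -/
theorem norm_iteratedFDeriv_fiberIntegral_le {K : Set (ι ⊕ κ → ℝ)} (hK : IsCompact K) (k : ℕ)
    {E : Type*} [NormedAddCommGroup E] [NormedSpace ℝ E] [CompleteSpace E]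
    {F : (ι ⊕ κ → ℝ) → E} (hF : ContDiff ℝ ∞ F)
    (hs : ∀ z ∉ K, F z = 0) {B : ℝ} (hB : ∀ z, ‖iteratedFDeriv ℝ k F z‖ ≤ B) (x : ι → ℝ) :
    ‖iteratedFDeriv ℝ k (fiberIntegral F) x‖ ≤ volume.real (projRight K) * B := by
  induction k generalizing E x with
  | zero =>
    simp only [norm_iteratedFDeriv_zero] at hB ⊢
    exact norm_fiberIntegral_le hK hs hB x
  | succ k ih =>
    have hcs : HasCompactSupport F := HasCompactSupport.intro hK hs
    have hd : fderiv ℝ (fiberIntegral F) =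
        fiberIntegral (fun z => (fderiv ℝ F z).comp (inlCLM ι κ)) :=
      funext fun y => (hasFDerivAt_fiberIntegral hF hcs y).fderiv
    have hF' : ContDiff ℝ ∞ (fderiv ℝ F) := hF.fderiv_right (by simp)
    rw [← norm_iteratedFDeriv_fderiv, hd]
    refine ih (hF'.clm_comp contDiff_const) (fun z hz => ?_) (fun z => ?_) x
    · have : fderiv ℝ F z = 0 := by
        by_contra h
        exact hz (closure_minimal (fun y hy => by
          by_contra h'
          exact hy (hs y h')) hK.isClosed (support_fderiv_subset ℝ h))
      rw [this, ContinuousLinearMap.zero_comp]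
    -- Restricting a derivative to the x-directions is a linear map of norm at most 1, so no
    -- constant accumulates along the induction.
    · set L := (ContinuousLinearMap.compL ℝ (ι → ℝ) (ι ⊕ κ → ℝ) E).flip (inlCLM ι κ) with hL
      have hL1 : ‖L‖ ≤ 1 := by
        refine ContinuousLinearMap.opNorm_le_bound _ zero_le_one fun T => ?_
        rw [hL, ContinuousLinearMap.flip_apply, ContinuousLinearMap.compL_apply, mul_comm]
        exact (T.opNorm_comp_le _).trans
          (mul_le_mul_of_nonneg_left norm_inlCLM_le (norm_nonneg _))
      have h := L.norm_iteratedFDeriv_comp_left (f := fderiv ℝ F) (x := z) (n := k) (N := ∞)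
        hF'.contDiffAt (by exact_mod_cast le_top)
      calc _ ≤ ‖L‖ * ‖iteratedFDeriv ℝ k (fderiv ℝ F) z‖ := h
        _ ≤ 1 * ‖iteratedFDeriv ℝ k (fderiv ℝ F) z‖ := by gcongr
        _ ≤ B := by rw [one_mul, norm_iteratedFDeriv_fderiv]; exact hB z

end FiberIntegral

/-! ### Fubini and fibre integrals of partial derivatives. -/

section Descent

variable {ι κ : Type} [Fintype ι] [Fintype κ]

theorem integral_eq_integral_fiberIntegral {g : (ι ⊕ κ → ℝ) → ℝ} (hg : Integrable g) :
    ∫ z, g z = ∫ x, fiberIntegral g x := by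
  have hm := volume_measurePreserving_sumPiEquivProdPi_symm (fun _ : ι ⊕ κ => ℝ)
  have hi : Integrable (fun q : (ι → ℝ) × (κ → ℝ) =>
      g ((MeasurableEquiv.sumPiEquivProdPi fun _ => ℝ).symm q)) (volume.prod volume) :=
    (hm.integrable_comp_emb (MeasurableEquiv.measurableEmbedding _)).2 hg
  have he : ∀ (x : ι → ℝ) (ξ : κ → ℝ),
      (MeasurableEquiv.sumPiEquivProdPi fun _ : ι ⊕ κ => ℝ).symm (x, ξ) = Sum.elim x ξ := by
    intro x ξ
    ext (i | k) <;> rfl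
  rw [← hm.integral_comp' g]
  refine (integral_prod _ hi).trans ?_
  simp only [he]
  rfl

theorem fiberIntegral_fderiv_inr [DecidableEq ι] [DecidableEq κ] {F : (ι ⊕ κ → ℝ) → ℝ}
    (hF : ContDiff ℝ ∞ F) (hs : HasCompactSupport F) (k : κ) (x : ι → ℝ) :
    fiberIntegral (fun z => fderiv ℝ F z (Pi.single (Sum.inr k) 1)) x = 0 := by
  have hv : (Pi.single (Sum.inr k) 1 : ι ⊕ κ → ℝ) = inrCLM ι κ (Pi.single k 1) := by
    ext (i | l) <;> simp [inrCLM_apply, Pi.single_apply]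
  have hd : ∀ ξ, fderiv ℝ (fun η : κ → ℝ => F (Sum.elim x η)) ξ (Pi.single k 1) =
      fderiv ℝ F (Sum.elim x ξ) (Pi.single (Sum.inr k) 1) := fun ξ => by
    have h : HasFDerivAt (fun η : κ → ℝ => F (Sum.elim x η))
        ((fderiv ℝ F (Sum.elim x ξ)).comp (inrCLM ι κ)) ξ :=
      ((hF.differentiable (by simp)).differentiableAt.hasFDerivAt).comp ξ
        (hasFDerivAt_sumElim_right x ξ)
    rw [h.fderiv, hv]
    rfl
  have hi := integrable_fiber hF.continuous hs x
  have hi' : Integrable (fun ξ : κ → ℝ =>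
      fderiv ℝ F (Sum.elim x ξ) (Pi.single (Sum.inr k) 1)) :=
    integrable_fiber ((hF.continuous_fderiv (by simp)).clm_apply continuous_const)
      (hs.fderiv_apply ℝ _) x
  -- Integration by parts against the constant function 1.
  have h := integral_mul_fderiv_eq_neg_fderiv_mul_of_integrable (μ := volume)
    (f := fun _ : κ → ℝ => (1 : ℝ)) (g := fun η => F (Sum.elim x η)) (v := Pi.single k 1)
    (by simp) (by simpa only [one_mul, hd] using hi') (by simpa only [one_mul] using hi)
    (fun _ _ => differentiableAt_const _)
    (fun ξ _ => ((hF.differentiable (by simp)).differentiableAt.comp ξ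
      (hasFDerivAt_sumElim_right x ξ).differentiableAt))
  simpa [hd, fiberIntegral] using h

theorem fiberIntegral_fderiv_inl [DecidableEq ι] [DecidableEq κ] {F : (ι ⊕ κ → ℝ) → ℝ}
    (hF : ContDiff ℝ ∞ F) (hs : HasCompactSupport F) (i : ι) (x : ι → ℝ) :
    fiberIntegral (fun z => fderiv ℝ F z (Pi.single (Sum.inl i) 1)) x =
      fderiv ℝ (fiberIntegral F) x (Pi.single i 1) := by
  have hv : (Pi.single (Sum.inl i) 1 : ι ⊕ κ → ℝ) = inlCLM ι κ (Pi.single i 1) := by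
    ext (j | l) <;> simp [inlCLM_apply, Pi.single_apply]
  have hi : Integrable (fun ξ : κ → ℝ => (fderiv ℝ F (Sum.elim x ξ)).comp (inlCLM ι κ)) := by
    refine integrable_fiber (F := fun z => (fderiv ℝ F z).comp (inlCLM ι κ))
      ((hF.continuous_fderiv (by simp)).clm_comp continuous_const) ?_ x
    exact (hs.fderiv ℝ).comp_left (g := fun T => T.comp (inlCLM ι κ))
      (ContinuousLinearMap.zero_comp _)
  rw [(hasFDerivAt_fiberIntegral hF hs x).fderiv, fiberIntegral, fiberIntegral,
    ContinuousLinearMap.integral_apply hi, hv]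
  rfl

/-! ### Lifted fields and their transposes. -/

/-- `Z̃` is a lift of `Z`: the two fields differ by a field that acts only in the fibre
variables. -/
def SmoothField.IsLiftOf (Zl : SmoothField (ι ⊕ κ)) (Z : SmoothField ι) : Prop :=
  ∀ z i, Zl z (Sum.inl i) = Z (fun k => z (Sum.inl k)) i

/-- In -∑ ∂_a(Z̃_a φ), the terms with `a` in the fibre are ξ-derivatives of compactly supported
functions and integrate to zero. In the remaining terms Z̃_a is constant along fibres, so it leaves
the integral, and ∂_a commutes with integration in ξ. -/
theorem SmoothField.IsLiftOf.fiberIntegral_transpose [DecidableEq ι] [DecidableEq κ]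
    {Zl : SmoothField (ι ⊕ κ)} {Z : SmoothField ι} (h : Zl.IsLiftOf Z) {φ : (ι ⊕ κ → ℝ) → ℝ}
    (hφ : ContDiff ℝ ∞ φ) (hs : HasCompactSupport φ) :
    fiberIntegral (Zl.transpose φ) = Z.transpose (fiberIntegral φ) := by
  funext x
  have hg : ∀ a, ContDiff ℝ ∞ (fun z => Zl z a * φ z) := fun a => (Zl.contDiff_coord a).mul hφ
  have hgs : ∀ a, HasCompactSupport (fun z => Zl z a * φ z) := fun a => hs.mul_left
  have hi : ∀ a, Integrable (fun ξ : κ → ℝ =>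
      fderiv ℝ (fun z => Zl z a * φ z) (Sum.elim x ξ) (Pi.single a 1)) := fun a =>
    integrable_fiber (F := fun y => fderiv ℝ (fun z => Zl z a * φ z) y (Pi.single a 1))
      (((hg a).continuous_fderiv (by simp)).clm_apply continuous_const)
      ((hgs a).fderiv_apply ℝ _) x
  have hl : ∀ i, fiberIntegral (fun z => Zl z (Sum.inl i) * φ z) =
      fun y => Z y i * fiberIntegral φ y := fun i => by
    funext y
    simp only [fiberIntegral, h _ i, Sum.elim_inl]
    exact integral_const_mul _ _
  have hr : ∀ k, ∫ ξ : κ → ℝ, fderiv ℝ (fun z => Zl z (Sum.inr k) * φ z) (Sum.elim x ξ)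
      (Pi.single (Sum.inr k) 1) = 0 := fun k => fiberIntegral_fderiv_inr (hg _) (hgs _) k x
  have hl' : ∀ i, ∫ ξ : κ → ℝ, fderiv ℝ (fun z => Zl z (Sum.inl i) * φ z) (Sum.elim x ξ)
      (Pi.single (Sum.inl i) 1) = fderiv ℝ (fun y => Z y i * fiberIntegral φ y) x
        (Pi.single i 1) := fun i => by
    rw [← hl i]
    exact fiberIntegral_fderiv_inl (hg _) (hgs _) i x
  simp only [fiberIntegral, SmoothField.transpose]
  rw [integral_neg, integral_finsetSum _ fun a _ => hi a, Fintype.sum_sum_type]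
  simp only [hr, hl', Finset.sum_const_zero, add_zero]
  rfl

/-! ### Continuity of fibre integration on test functions. -/

/-- Integration over the fibres of a smooth function supported in a compact set, as a linear
map. -/
noncomputable def fiberIntegralSupportedInLM (K : Compacts (ι ⊕ κ → ℝ)) :
    𝓓_{K}(ι ⊕ κ → ℝ, ℝ) →ₗ[ℝ]
      𝓓_{⟨projLeft (K : Set (ι ⊕ κ → ℝ)), isCompact_projLeft K.isCompact⟩}(ι → ℝ, ℝ) where
  toFun φ := ⟨fiberIntegral φ, contDiff_fiberIntegral φ.contDiff φ.hasCompactSupport,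
    fun x hx => fiberIntegral_eq_zero (fun z hz => φ.zero_on_compl hz) hx⟩
  map_add' φ ψ := ContDiffMapSupportedIn.ext fun x => by
    exact integral_add (integrable_fiber φ.continuous φ.hasCompactSupport x)
      (integrable_fiber ψ.continuous ψ.hasCompactSupport x)
  map_smul' a φ := ContDiffMapSupportedIn.ext fun x => by
    exact integral_const_mul a fun ξ : κ → ℝ => φ (Sum.elim x ξ)

/-- Integration over the fibres of a smooth function supported in a compact set, as a continuous
linear map. -/
noncomputable def fiberIntegralSupportedIn (K : Compacts (ι ⊕ κ → ℝ)) :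
    𝓓_{K}(ι ⊕ κ → ℝ, ℝ) →L[ℝ]
      𝓓_{⟨projLeft (K : Set (ι ⊕ κ → ℝ)), isCompact_projLeft K.isCompact⟩}(ι → ℝ, ℝ) where
  toLinearMap := fiberIntegralSupportedInLM K
  cont := by
    refine WithSeminorms.continuous_of_isBounded (ContDiffMapSupportedIn.withSeminorms ℝ _ _ _ _)
      (ContDiffMapSupportedIn.withSeminorms ℝ _ _ _ _) (fiberIntegralSupportedInLM K)
      -- The order-`i` seminorm is controlled by the order-`i` seminorm alone, with the volume of
      -- the ξ-projection of `K` as constant.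
      (.of_real fun i => ⟨{i}, volume.real (projRight (K : Set (ι ⊕ κ → ℝ))), fun φ => ?_⟩)
    rw [Finset.sup_singleton]
    refine (ContDiffMapSupportedIn.seminorm_top_le_iff ℝ
      (mul_nonneg measureReal_nonneg (apply_nonneg _ _)) i _).2 fun x _ => ?_
    exact norm_iteratedFDeriv_fiberIntegral_le K.isCompact i φ.contDiff
      (fun z hz => φ.zero_on_compl hz)
      (fun z => ContDiffMapSupportedIn.norm_iteratedFDeriv_apply_le_seminorm_top ℝ) x

/-- Integration over the fibres of a test function. -/
noncomputable def TestFunction.fiberIntegral (φ : 𝓓((⊤ : Opens (ι ⊕ κ → ℝ)), ℝ)) :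
    𝓓((⊤ : Opens (ι → ℝ)), ℝ) where
  toFun := _root_.fiberIntegral φ
  contDiff' := contDiff_fiberIntegral φ.contDiff φ.hasCompactSupport
  hasCompactSupport' :=
    (isCompact_projLeft φ.hasCompactSupport).of_isClosed_subset (isClosed_tsupport _)
      (tsupport_fiberIntegral_subset φ.hasCompactSupport)
  tsupport_subset' _ _ := trivial

/-- Integration over the fibres, as a continuous linear map on test functions. -/
noncomputable def fiberIntegralTest (ι κ : Type) [Fintype ι] [Fintype κ] :
    𝓓((⊤ : Opens (ι ⊕ κ → ℝ)), ℝ) →L[ℝ] 𝓓((⊤ : Opens (ι → ℝ)), ℝ) :=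
  -- Continuity for the inductive limit topology is checked on each `𝓓_{K}`, where the map factors
  -- through functions supported in the projection of `K`.
  TestFunction.limitCLM ℝ TestFunction.fiberIntegral
    (fun K _ => (TestFunction.ofSupportedInCLM ℝ (Set.subset_univ _)).comp
      (fiberIntegralSupportedIn K))
    (fun _ _ _ => rfl)

/-- Continuity of `f` on `U` suffices: the product is continuous everywhere because it vanishes near
each point outside the support of `φ`. -/
theorem integrable_mul_of_tsupport_subset {Ω : Opens (ι → ℝ)} {U : Set (ι → ℝ)} (hU : IsOpen U)
    {f : (ι → ℝ) → ℝ} (hf : ContinuousOn f U) (φ : 𝓓(Ω, ℝ)) (hφ : tsupport φ ⊆ U) :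
    Integrable (fun x => f x * φ x) := by
  refine Continuous.integrable_of_hasCompactSupport ?_ φ.hasCompactSupport.mul_left
  refine continuous_of_tsupport fun x hx => ?_
  have hx' : x ∈ tsupport φ := tsupport_mul_subset_right hx
  exact (hf.continuousAt (hU.mem_nhds (hφ hx'))).mul φ.continuous.continuousAt

/-! ### Tensor products with 1 and with a cutoff. -/

/-- The distribution `Λ ⊗ 1` on `ℝ^ι × ℝ^κ`. -/
noncomputable def Distribution.tensorOne (κ : Type) [Fintype κ]
    (Λ : 𝓓'((⊤ : Opens (ι → ℝ)), ℝ)) : 𝓓'((⊤ : Opens (ι ⊕ κ → ℝ)), ℝ) where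
  toFun φ := Λ (fiberIntegralTest ι κ φ)
  map_add' φ ψ := by rw [map_add, map_add]
  map_smul' a φ := by rw [map_smul, map_smul]; rfl
  cont := (map_continuous Λ).comp (fiberIntegralTest ι κ).continuous

theorem Distribution.tensorOne_apply (Λ : 𝓓'((⊤ : Opens (ι → ℝ)), ℝ))
    (φ : 𝓓((⊤ : Opens (ι ⊕ κ → ℝ)), ℝ)) :
    Λ.tensorOne κ φ = Λ (fiberIntegralTest ι κ φ) := rfl

/-- The test function `(x, ξ) ↦ φ(x) χ(ξ)`. -/
noncomputable def tensorTest (φ : 𝓓((⊤ : Opens (ι → ℝ)), ℝ)) (χ : 𝓓((⊤ : Opens (κ → ℝ)), ℝ)) :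
    𝓓((⊤ : Opens (ι ⊕ κ → ℝ)), ℝ) where
  toFun z := φ (fun i => z (Sum.inl i)) * χ (fun k => z (Sum.inr k))
  contDiff' := (φ.contDiff.comp (contDiff_pi.2 fun i => contDiff_apply ℝ ℝ _)).mul
    (χ.contDiff.comp (contDiff_pi.2 fun i => contDiff_apply ℝ ℝ _))
  hasCompactSupport' := by
    refine HasCompactSupport.intro ((φ.hasCompactSupport.isCompact.prod
      χ.hasCompactSupport.isCompact).image (contDiff_sumElim (n := 0)).continuous) fun z hz => ?_
    by_contra h
    refine hz ⟨(_, _), ⟨subset_tsupport _ (left_ne_zero_of_mul h),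
      subset_tsupport _ (right_ne_zero_of_mul h)⟩, ?_⟩
    ext (i | k) <;> rfl
  tsupport_subset' := fun _ _ => trivial

theorem tsupport_tensorTest_subset (φ : 𝓓((⊤ : Opens (ι → ℝ)), ℝ))
    (χ : 𝓓((⊤ : Opens (κ → ℝ)), ℝ)) :
    tsupport (tensorTest φ χ) ⊆ (fun z i => z (Sum.inl i)) ⁻¹' tsupport φ :=
  closure_minimal (fun _ hz => subset_tsupport _ (left_ne_zero_of_mul hz))
    ((isClosed_tsupport _).preimage (by fun_prop))

/-- Thus φ ↦ φ ⊗ χ is a right inverse of fibre integration, which recovers `Λ` from Λ ⊗ 1. -/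
theorem fiberIntegralTest_tensorTest (φ : 𝓓((⊤ : Opens (ι → ℝ)), ℝ))
    {χ : 𝓓((⊤ : Opens (κ → ℝ)), ℝ)} (hχ : ∫ ξ, χ ξ = 1) :
    fiberIntegralTest ι κ (tensorTest φ χ) = φ := by
  ext x
  change ∫ ξ, φ x * χ ξ = φ x
  rw [integral_const_mul, hχ, mul_one]

theorem exists_test_integral_eq_one (κ : Type) [Fintype κ] :
    ∃ χ : 𝓓((⊤ : Opens (κ → ℝ)), ℝ), ∫ ξ, χ ξ = 1 := by
  let b : ContDiffBump (0 : κ → ℝ) := default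
  exact ⟨⟨b.normed volume, b.contDiff_normed, b.hasCompactSupport_normed, fun _ _ => trivial⟩,
    b.integral_normed⟩

/-! ### Descent of hypoellipticity. -/

variable {α : Type} [DecidableEq ι] [DecidableEq κ]

/-- The transpose of the first letter acts first, so the induction must vary `φ`. -/
theorem fiberIntegralTest_wordTranspose {X : α → SmoothField ι} {Xl : α → SmoothField (ι ⊕ κ)}
    (h : ∀ j, (Xl j).IsLiftOf (X j)) (I : List α) (φ : 𝓓((⊤ : Opens (ι ⊕ κ → ℝ)), ℝ)) :
    fiberIntegralTest ι κ (wordTranspose Xl I φ) = wordTranspose X I (fiberIntegralTest ι κ φ) := by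
  induction I generalizing φ with
  | nil => rfl
  | cons j I ih =>
    refine (ih _).trans (congrArg (wordTranspose X I) ?_)
    exact DFunLike.coe_injective ((h j).fiberIntegral_transpose φ.contDiff φ.hasCompactSupport)

theorem fiberIntegralTest_diffOpTranspose {X : α → SmoothField ι}
    {Xl : α → SmoothField (ι ⊕ κ)} (h : ∀ j, (Xl j).IsLiftOf (X j)) (c : List α →₀ ℝ)
    (φ : 𝓓((⊤ : Opens (ι ⊕ κ → ℝ)), ℝ)) :
    fiberIntegralTest ι κ (diffOpTranspose Xl c φ) =
      diffOpTranspose X c (fiberIntegralTest ι κ φ) := by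
  simp only [diffOpTranspose, map_sum, map_smul, fiberIntegralTest_wordTranspose h]

/-- If a family of fields on `ℝ^ι × ℝ^κ` lifts a family on `ℝ^ι`, then hypoellipticity of the
lifted operator `∑ c_I X̃_I` implies that of `∑ c_I X_I`. -/
theorem HypoellipticIn.of_lift {X : α → SmoothField ι} {Xl : α → SmoothField (ι ⊕ κ)}
    (h : ∀ j, (Xl j).IsLiftOf (X j)) {c : List α →₀ ℝ} (hyp : HypoellipticIn ⊤ Xl c) :
    HypoellipticIn ⊤ X c := by
  rintro Λ Ω' - ⟨f, hf, hΛ⟩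
  have hpr : ContDiff ℝ ∞ (fun (z : ι ⊕ κ → ℝ) (i : ι) => z (Sum.inl i)) :=
    contDiff_pi.2 fun i => contDiff_apply ℝ ℝ _
  let Ωl : Opens (ι ⊕ κ → ℝ) :=
    ⟨(fun z i => z (Sum.inl i)) ⁻¹' Ω', Ω'.isOpen.preimage hpr.continuous⟩
  have hfl : ContDiffOn ℝ ∞ (fun z : ι ⊕ κ → ℝ => f fun i => z (Sum.inl i)) Ωl :=
    hf.comp hpr.contDiffOn fun _ hz => hz
  -- The density supplied for 𝓛̃(Λ ⊗ 1) on the cylinder is f ∘ π; being constant on fibres, it comes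
  -- out of the ξ-integral.
  obtain ⟨u, hu, hΛu⟩ := hyp (Λ.tensorOne κ) Ωl le_top ⟨_, hfl, fun φ hφ => by
    have hφ' : tsupport (fiberIntegralTest ι κ φ) ⊆ Ω' :=
      (tsupport_fiberIntegral_subset φ.hasCompactSupport).trans (Set.image_subset_iff.2 hφ)
    change Λ (fiberIntegralTest ι κ _) = _
    rw [fiberIntegralTest_diffOpTranspose h, show Λ _ = _ from hΛ _ hφ',
      integral_eq_integral_fiberIntegral
        (integrable_mul_of_tsupport_subset Ωl.isOpen hfl.continuousOn φ hφ)]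
    exact integral_congr_ae (.of_forall fun x => (integral_const_mul _ _).symm)⟩
  obtain ⟨χ, hχ⟩ := exists_test_integral_eq_one κ
  -- Averaging against χ yields a function of x alone, so there is no need to prove that u is
  -- independent of ξ.
  refine ⟨fun x => ∫ ξ : κ → ℝ, u (Sum.elim x ξ) * χ ξ, ?_, fun φ hφ => ?_⟩
  · refine contDiffOn_integral_of_compact Ω'.isOpen χ.hasCompactSupport.isCompact
      (fun p ξ _ hξ => by rw [image_eq_zero_of_notMem_tsupport hξ, mul_zero]) ?_
    exact (hu.comp contDiff_sumElim.contDiffOn fun q hq => hq.1).mul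
      (χ.contDiff.comp contDiff_snd).contDiffOn
  · have hs : tsupport (tensorTest φ χ) ⊆ Ωl :=
      (tsupport_tensorTest_subset φ χ).trans (Set.preimage_mono hφ)
    have h1 := hΛu (tensorTest φ χ) hs
    simp only [Distribution.tensorOne_apply, fiberIntegralTest_tensorTest φ hχ] at h1
    change Λ φ = _
    rw [h1, integral_eq_integral_fiberIntegral
      (integrable_mul_of_tsupport_subset Ωl.isOpen hu.continuousOn _ hs)]
    refine integral_congr_ae (.of_forall fun x => ?_)
    change ∫ ξ, u (Sum.elim x ξ) * (φ x * χ ξ) = (∫ ξ, u (Sum.elim x ξ) * χ ξ) * φ x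
    rw [← integral_mul_const]
    exact integral_congr_ae (.of_forall fun ξ => by ring)

end Descent

theorem theorem1 {n m : ℕ} [NeZero n] (σ : Fin n → ℕ) (ν : Fin m → ℕ)
    (X : Fin m → SmoothField (Fin n)) (d : ℕ) (c : List (Fin m) →₀ ℝ)
    (h : IsGeneralizedRockland σ ν X d c) :
    HypoellipticIn ⊤ X c := by
  obtain ⟨p, τ, G, Xl, hl, hyp⟩ := h.lifted_hypoelliptic
  exact hyp.of_lift hl.lifts
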